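/- Let $\lambda>0$, $M>0$, $\delta=\lambda M$, and $K=lM$ with an integer $l\ge 2$. Consider the storage process $$B(i+1)=\min\bigl(B(i)-M\,\mathbf 1_{\{B(i)>M\}}+X(i),\,K\bigr),\qquad i=0,1,2,\dots,$$ on the state space $[0,K]$, where the $X(i)$ are i.i.d. exponential random variables with density $f(x)=\lambda e^{-\lambda x}$, $x\ge 0$, and are independent of the initial level $B(0)\in[0,K]$, whose law is arbitrary. Then this Markov chain has a unique stationary distribution on $[0,K]$, and the law of $B(i)$ converges to it in total variation. This limiting distribution has a density $g$ on $[0,K)$ and an atom of mass $\pi(K)>0$ at $K$, and (with the convention $0^0=1$) $g$ can be chosen so that $$g(x)=\pi(K)\,\lambda e^{-\delta(1-l)}\sum_{q=0}^{l-2}\frac{e^{-\delta q}}{q!}\Bigl[\bigl(\delta(q+1)-\lambda K\bigr)^q-e^{-\lambda x}\bigl(\delta(q+1)+\lambda(x-K)\bigr)^q\Bigr],\qquad 0\le x<M,$$ and, for $n=0,\dots,l-2$ and $K-(n+1)M\le x<K-nM$, $$g(x)=\pi(K)\,\lambda e^{-\lambda(x-K)}\Bigl[1+\sum_{q=1}^{n}\frac{e^{-\delta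 q}}{(q-1)!}\bigl(\delta q+\lambda(x-K)\bigr)^{q-1}\Bigl(\frac{\lambda(x-K)}{q}+\delta-1\Bigr)\Bigr],$$ where $$\pi(K)=\Biggl\{1+\sum_{n=0}^{l-2}e^{n\delta}\sum_{q=0}^{n}\frac{(\delta e^{-\delta})^q}{q!}\Bigl(e^{\delta}\bigl(q-(n+1)\bigr)^q-(q-n)^q\Bigr)+e^{-\delta(1-l)}\sum_{q=0}^{l-2}\frac{e^{-\delta q}}{q!}\Bigl[e^{\delta(q+1-l)}\Bigl(\Gamma\bigl(q+1,\delta(q+2-l)\bigr)-\Gamma\bigl(q+1,\delta(q+1-l)\bigr)\Bigr)+\delta\bigl(\delta(q+1-l)\bigr)^q\Bigr]\Biggr\}^{-1}.$$ Here $\Gamma(s,z)=\int_z^\infty t^{s-1}e^{-t}\,dt$ is the upper incomplete gamma function, for a positive integer $s$ and any real $z$. -/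

import Mathlib

open MeasureTheory ProbabilityTheory Filter Set

noncomputable section

/-- One step of the energy buffer of capacity `K` under the on-off policy with transmit power `M`:
from level `b` and harvested energy `x` the next level is `min (b - M * 1_{b > M} + x) K`. -/
def bufferStep (M K b x : ℝ) : ℝ :=
  min (b - (if M < b then M else 0) + x) K

/-- `B` is the storage process with state space `[0, K]`, power `M` and harvested energies `X`,
which are i.i.d. with law `ρ` and independent of the (arbitrary) initial level `B 0`. -/
structure IsStorageProcess {Ω : Type*} [MeasurableSpace Ω] (P : Measure Ω) (M K : ℝ)
    (ρ : Measure ℝ) (X B : ℕ → Ω → ℝ) : Prop where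
  measurable_energy : ∀ i, Measurable (X i)
  law_energy : ∀ i, P.map (X i) = ρ
  indep_energy : iIndepFun X P
  measurable_init : Measurable (B 0)
  init_mem : ∀ ω, B 0 ω ∈ Icc 0 K
  indep_init : IndepFun (B 0) (fun ω i => X i ω) P
  step : ∀ i ω, B (i + 1) ω = bufferStep M K (B i ω) (X i ω)

/-- `μ` is a stationary distribution on the state space `[0, K]` of the storage Markov chain with
power `M` and harvested-energy law `ρ`. -/
structure IsStationaryDistribution (M K : ℝ) (ρ μ : Measure ℝ) : Prop where
  isProbabilityMeasure : IsProbabilityMeasure μ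
  mem_space : μ (Icc 0 K) = 1
  invariant : (μ.prod ρ).map (fun p : ℝ × ℝ => bufferStep M K p.1 p.2) = μ

/-- Convergence in total variation of a sequence of (finite) measures on `ℝ`. -/
def ConvergesInTotalVariation (ν : ℕ → Measure ℝ) (μ : Measure ℝ) : Prop :=
  ∀ ε > 0, ∀ᶠ n in atTop, ∀ A : Set ℝ, MeasurableSet A → |(ν n).real A - μ.real A| ≤ ε

/-- `μ` is a limiting distribution of the storage process `B`: it is a stationary distribution and
the law of `B n` converges to it in total variation. -/
structure IsLimitingDistribution {Ω : Type*} [MeasurableSpace Ω] (P : Measure Ω) (M K : ℝ)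
    (ρ : Measure ℝ) (B : ℕ → Ω → ℝ) (μ : Measure ℝ) : Prop where
  stationary : IsStationaryDistribution M K ρ μ
  tendsto : ConvergesInTotalVariation (fun n => P.map (B n)) μ

/-- `g` is a probability density function of (the absolutely continuous) `μ` on the set `S`. -/
structure IsDensityOn (μ : Measure ℝ) (S : Set ℝ) (g : ℝ → ℝ) : Prop where
  nonneg : ∀ x ∈ S, 0 ≤ g x
  integrableOn : IntegrableOn g S
  measure_eq : ∀ A : Set ℝ, MeasurableSet A → A ⊆ S → μ.real A = ∫ x in A, g x

/-- The upper incomplete gamma function `Γ(s, z) = ∫_z^∞ t^(s-1) e^(-t) dt` at a positive integer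
`s` and a real `z` of any sign. -/
def upperGamma (s : ℕ) (z : ℝ) : ℝ :=
  ∫ t in Ioi z, t ^ (s - 1) * Real.exp (-t)

end

/-! The chain is a Doeblin chain: whatever the level, a harvest of at least `K` fills the buffer in
one step, so `K` is an atom of every transition law with mass at least `P(X ≥ K) > 0`. Splitting
off this atom, the transition operator contracts the distance between two laws by the factor
`P(X < K) < 1` (`abs_integral_sub_le`). This gives both uniqueness of the stationary distribution
and convergence in total variation from any initial law, once one stationary distribution is known.

The law with density `g` on `[0, K)` and atom `p` at `K` is stationary when it has total mass one,
`g ≥ 0`, and `g t = ∫ b in [0, K), k b t * g b + p * k K t` for `t ∈ [0, K)`, where `k b t` is the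
density at `t` of the next level given the level `b` (`IsBalanced`,
`isStationaryDistribution_mixedLaw`); the atom takes care of itself, because the remaining mass has
nowhere else to go.

Write `g x = p * lam * exp (-y) * φ x` with `y = lam * (x - K)`. The balance equation then becomes
`φ 0 = 0`, `φ' = lam * φ + lam * e^(-δ) * φ (· + M)` on `[0, M)`,
`φ' = lam * e^(-δ) * φ (· + M)` on `[M, K - M)`, `φ = 1` on `[K - M, K)`, with `φ` continuous except
for a jump `e^(-δ)` at `K - M`. It is solved in terms of the sums
`A n y = ∑ q ≤ n, e^(-δ q) (δ q + y)^q / q!`, for which `(A (n + 1))' y = e^(-δ) * A n (y + δ)`: on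
the `n`-th interval of length `M` below `K`, `φ = A n - (A n)'` (`upperProfile`), and on `[0, M)` the
solution is `lowerProfile`. The equations are integrated interval by interval in
`integral_profile_level` and assembled in `profile_balance`.

The closed formula has alternating signs, so `g ≥ 0` is not visible from it. It follows from the
balance equation: the negative part of `g` satisfies `g⁻ t ≤ ∫ b, k b t * g⁻ b`, and integrating
over `t` bounds the integral of `g⁻` by `P(X < K) < 1` times itself (`IsBalanced.nonneg`). Finally
`p` is fixed by total mass one; the integral over each upper interval is elementary since
`e^(-y) (A n - (A n)') = -(e^(-y) A n)'`, and the one over `[0, M)` yields the incomplete gamma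
functions. -/

namespace StorageProcess

/-! ### The polynomial sums and their delay equations -/

/-- The polynomial `∑ q ≤ n, e^(-δ q) (δ q + y)^q / q!`. -/
noncomputable def abelSum (δ : ℝ) (n : ℕ) (y : ℝ) : ℝ :=
  ∑ q ∈ Finset.range (n + 1), Real.exp (-δ * q) / (q.factorial : ℝ) * (δ * q + y) ^ q

/-- The derivative of `abelSum δ n`, with the summation index shifted to start at `0`. -/
noncomputable def abelSumDeriv (δ : ℝ) (n : ℕ) (y : ℝ) : ℝ :=
  ∑ q ∈ Finset.range n, Real.exp (-δ * (q + 1)) / (q.factorial : ℝ) * (δ * (q + 1) + y) ^ q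

/-- The factor `φ` of the stationary density on `[K - (n + 1) M, K - n M)`, as a function of
`y = lam * (x - K)`. -/
noncomputable def upperProfile (δ : ℝ) (n : ℕ) (y : ℝ) : ℝ :=
  abelSum δ n y - abelSumDeriv δ n y

/-- The factor `φ` of the stationary density on `[0, M)` when `K = l M`, as a function of
`y = lam * (x - K)`. The constant in front of the exponential makes it vanish at `x = 0`. -/
noncomputable def lowerProfile (δ : ℝ) (l : ℕ) (y : ℝ) : ℝ :=
  Real.exp (y + δ * l) * abelSumDeriv δ (l - 1) (-δ * l) - abelSumDeriv δ (l - 1) y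

/-- The functional equation behind the whole computation: differentiating `abelSum` shifts its
argument by `δ` and lowers its degree. -/
lemma abelSumDeriv_succ (δ : ℝ) (n : ℕ) (y : ℝ) :
    abelSumDeriv δ (n + 1) y = Real.exp (-δ) * abelSum δ n (y + δ) := by
  unfold abelSumDeriv abelSum
  rw [Finset.mul_sum]
  refine Finset.sum_congr rfl fun q _ => ?_
  rw [show -δ * ((q : ℝ) + 1) = -δ + -δ * q by ring, Real.exp_add]
  rw [show δ * ((q : ℝ) + 1) + y = δ * q + (y + δ) by ring]
  ring

lemma hasDerivAt_abelSum (δ : ℝ) (n : ℕ) (y : ℝ) :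
    HasDerivAt (abelSum δ n) (abelSumDeriv δ n y) y := by
  have h : ∀ q ∈ Finset.range (n + 1), HasDerivAt
      (fun z : ℝ => Real.exp (-δ * q) / (q.factorial : ℝ) * (δ * q + z) ^ q)
      (Real.exp (-δ * q) / (q.factorial : ℝ) * (q * (δ * q + y) ^ (q - 1))) y := fun q _ => by
    simpa using (((hasDerivAt_id y).const_add (δ * q)).pow q).const_mul
      (Real.exp (-δ * q) / (q.factorial : ℝ))
  have := HasDerivAt.fun_sum h
  convert! this using 1
  rw [Finset.sum_range_succ']
  simp only [abelSumDeriv, CharP.cast_eq_zero, zero_mul, mul_zero, add_zero]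
  refine Finset.sum_congr rfl fun q _ => ?_
  rw [Nat.factorial_succ]
  have := Nat.factorial_ne_zero q
  push_cast
  field_simp

@[simp] lemma abelSumDeriv_zero (δ y : ℝ) : abelSumDeriv δ 0 y = 0 := by simp [abelSumDeriv]

@[simp] lemma upperProfile_zero (δ y : ℝ) : upperProfile δ 0 y = 1 := by
  simp [upperProfile, abelSum]

lemma hasDerivAt_abelSumDeriv (δ : ℝ) (n : ℕ) (y : ℝ) :
    HasDerivAt (abelSumDeriv δ (n + 1)) (Real.exp (-δ) * abelSumDeriv δ n (y + δ)) y := by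
  have h : abelSumDeriv δ (n + 1) = fun z => Real.exp (-δ) * abelSum δ n (z + δ) :=
    funext (abelSumDeriv_succ δ n)
  rw [h]
  exact ((hasDerivAt_abelSum δ n (y + δ)).comp_add_const y δ).const_mul _

lemma exp_mul_upperProfile (δ : ℝ) (n : ℕ) (y : ℝ) :
    Real.exp (-δ) * upperProfile δ n (y + δ) =
      abelSumDeriv δ (n + 1) y - Real.exp (-δ) * abelSumDeriv δ n (y + δ) := by
  rw [upperProfile, mul_sub, ← abelSumDeriv_succ]

/-- The delay equation of the profile at the levels above `M`. -/
lemma hasDerivAt_upperProfile (δ : ℝ) (n : ℕ) (y : ℝ) :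
    HasDerivAt (upperProfile δ (n + 1)) (Real.exp (-δ) * upperProfile δ n (y + δ)) y := by
  rw [exp_mul_upperProfile]
  exact (hasDerivAt_abelSum δ (n + 1) y).sub (hasDerivAt_abelSumDeriv δ n y)

/-- The delay equation of the profile at the levels below `M`, where no energy is drained. -/
lemma hasDerivAt_lowerProfile (δ : ℝ) (n : ℕ) (y : ℝ) :
    HasDerivAt (lowerProfile δ (n + 2))
      (lowerProfile δ (n + 2) y + Real.exp (-δ) * upperProfile δ n (y + δ)) y := by
  rw [exp_mul_upperProfile]
  have h := ((((hasDerivAt_id y).add_const (δ * (n + 2 : ℕ))).exp).mul_const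
    (abelSumDeriv δ (n + 1) (-δ * (n + 2 : ℕ)))).sub (hasDerivAt_abelSumDeriv δ n y)
  convert! h using 1
  simp [lowerProfile]

lemma lowerProfile_bottom (δ : ℝ) (l : ℕ) : lowerProfile δ l (-δ * l) = 0 := by
  simp [lowerProfile]

/-- At the level `x = M` the lower profile meets the polynomial of the next degree up. For `l > 2`
this is continuity at `M`; for `l = 2` it includes the jump at `M = K - M`. -/
lemma lowerProfile_top (δ : ℝ) (n : ℕ) :
    lowerProfile δ (n + 2) (-δ * (n + 1)) = upperProfile δ (n + 1) (-δ * (n + 1)) := by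
  have h : abelSum δ (n + 1) (-δ * (n + 1)) = abelSum δ n (-δ * (n + 1)) := by
    rw [abelSum, Finset.sum_range_succ]
    simp [abelSum]
  rw [lowerProfile, upperProfile, h]
  simp only [show n + 2 - 1 = n + 1 from rfl]
  rw [abelSumDeriv_succ δ n (-δ * (n + 2 : ℕ)), ← mul_assoc, ← Real.exp_add]
  push_cast
  rw [show -δ * (n + 1) + δ * (n + 2) + -δ = (0 : ℝ) by ring,
    show -δ * (n + 2) + δ = -δ * (n + 1 : ℝ) by ring]
  simp

/-- The left limit of the profile at the level `K - M`: it misses the value `1` on the right by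
`e^(-δ)`, the contribution of the atom at `K`. -/
lemma upperProfile_one_neg (δ : ℝ) :
    upperProfile δ 1 (-δ) = 1 - Real.exp (-δ) := by
  simp [upperProfile, abelSum, abelSumDeriv, Finset.sum_range_succ]

/-- Consecutive upper profiles agree at the level separating their intervals, below `K - M`. -/
lemma upperProfile_match (δ : ℝ) (n : ℕ) :
    upperProfile δ (n + 2) (-δ * (n + 2)) = upperProfile δ (n + 1) (-δ * (n + 2)) := by
  rw [upperProfile, upperProfile, abelSum, abelSumDeriv, Finset.sum_range_succ,
    Finset.sum_range_succ (n := n + 1) (f := fun q : ℕ =>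
      Real.exp (-δ * (q + 1)) / (q.factorial : ℝ) * (δ * (q + 1) + -δ * (n + 2)) ^ q)]
  simp only [abelSum, abelSumDeriv]
  push_cast
  rw [show δ * ((n : ℝ) + 1 + 1) + -δ * (n + 2) = 0 by ring,
    show δ * ((n : ℝ) + 2) + -δ * (n + 2) = 0 by ring]
  simp

lemma continuous_abelSum (δ : ℝ) (n : ℕ) : Continuous (abelSum δ n) := by
  unfold abelSum; fun_prop

lemma continuous_abelSumDeriv (δ : ℝ) (n : ℕ) : Continuous (abelSumDeriv δ n) := by
  unfold abelSumDeriv; fun_prop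

lemma continuous_upperProfile (δ : ℝ) (n : ℕ) : Continuous (upperProfile δ n) :=
  (continuous_abelSum δ n).sub (continuous_abelSumDeriv δ n)

lemma continuous_lowerProfile (δ : ℝ) (l : ℕ) : Continuous (lowerProfile δ l) := by
  have := continuous_abelSumDeriv δ (l - 1)
  unfold lowerProfile; fun_prop

/-! ### The profile and its balance equation -/

/-- The stationary density at `x ∈ [0, K)` divided by `π(K) * lam * e^(-lam (x - K))`. For
`x ∈ [K - (n + 1) M, K - n M)` the ceiling equals `n + 1`. -/
noncomputable def profile (lam M K : ℝ) (l : ℕ) (x : ℝ) : ℝ :=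
  if x < M then lowerProfile (lam * M) l (lam * (x - K))
  else upperProfile (lam * M) (⌈(K - x) / M⌉₊ - 1) (lam * (x - K))

section Profile

variable {lam M K : ℝ} {m : ℕ}

lemma profile_lower {x : ℝ} (l : ℕ) (hx : x < M) :
    profile lam M K l x = lowerProfile (lam * M) l (lam * (x - K)) := if_pos hx

lemma profile_upper (hM : 0 < M) (hK : K = (m + 2) * M) {n : ℕ} (hn : n ≤ m) {x : ℝ}
    (hx : x ∈ Ico (K - (n + 1) * M) (K - n * M)) (l : ℕ) :
    profile lam M K l x = upperProfile (lam * M) n (lam * (x - K)) := by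
  have hnm : (n : ℝ) * M ≤ m * M := by gcongr
  have h1 : ¬ x < M := by have := hx.1; rw [hK] at this; nlinarith
  have h2 : ⌈(K - x) / M⌉₊ = n + 1 := by
    rw [Nat.ceil_eq_iff (by simp)]
    simp only [Nat.add_sub_cancel]
    push_cast
    rw [lt_div_iff₀ hM, div_le_iff₀ hM]
    constructor <;> linarith [hx.1, hx.2]
  rw [profile, if_neg h1, h2, Nat.add_sub_cancel]

lemma exists_mem_piece (hM : 0 < M) (hK : K = (m + 2) * M) {x : ℝ} (hx : x ∈ Ico M K) :
    ∃ n ≤ m, x ∈ Ico (K - (n + 1) * M) (K - n * M) := by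
  have hpos : 0 < (K - x) / M := div_pos (by linarith [hx.2]) hM
  obtain ⟨n, hn⟩ : ∃ n, ⌈(K - x) / M⌉₊ = n + 1 :=
    Nat.exists_eq_succ_of_ne_zero (Nat.ceil_pos.2 hpos).ne'
  have h := hn
  rw [Nat.ceil_eq_iff (by simp)] at h
  simp only [Nat.add_sub_cancel] at h
  push_cast at h
  rw [lt_div_iff₀ hM, div_le_iff₀ hM] at h
  refine ⟨n, ?_, by constructor <;> linarith⟩
  have : ⌈(K - x) / M⌉₊ ≤ m + 1 := by
    rw [Nat.ceil_le, div_le_iff₀ hM]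
    push_cast
    have := hx.1
    rw [hK]; linarith
  omega

lemma intervalIntegrable_profile_lower (l : ℕ) {a b : ℝ} (hab : a ≤ b) (hb : b ≤ M) :
    IntervalIntegrable (profile lam M K l) volume a b := by
  have hc : Continuous fun x => lowerProfile (lam * M) l (lam * (x - K)) :=
    (continuous_lowerProfile _ _).comp (by fun_prop)
  refine (hc.intervalIntegrable a b).congr_uIoo fun x hx => ?_
  rw [uIoo_of_le hab] at hx
  exact (profile_lower l (hx.2.trans_le hb)).symm

lemma intervalIntegrable_profile_piece (hM : 0 < M) (hK : K = (m + 2) * M) {n : ℕ} (hn : n ≤ m)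
    (l : ℕ) {a b : ℝ} (ha : K - (n + 1) * M ≤ a) (hab : a ≤ b) (hb : b ≤ K - n * M) :
    IntervalIntegrable (profile lam M K l) volume a b := by
  have hc : Continuous fun x => upperProfile (lam * M) n (lam * (x - K)) :=
    (continuous_upperProfile _ _).comp (by fun_prop)
  refine (hc.intervalIntegrable a b).congr_uIoo fun x hx => ?_
  rw [uIoo_of_le hab] at hx
  exact (profile_upper hM hK hn ⟨ha.trans hx.1.le, hx.2.trans_le hb⟩ l).symm

lemma integral_profile_piece (hM : 0 < M) (hK : K = (m + 2) * M) {n : ℕ} (hn : n ≤ m)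
    (l : ℕ) {a b : ℝ} (ha : K - (n + 1) * M ≤ a) (hab : a ≤ b) (hb : b ≤ K - n * M) :
    ∫ x in a..b, lam * (Real.exp (-(lam * M)) * profile lam M K l x) =
      upperProfile (lam * M) (n + 1) (lam * (b - M - K)) -
        upperProfile (lam * M) (n + 1) (lam * (a - M - K)) := by
  refine intervalIntegral.integral_eq_sub_of_hasDerivAt_of_le
    (f := fun x => upperProfile (lam * M) (n + 1) (lam * (x - M - K))) hab
    ((continuous_upperProfile _ _).comp (by fun_prop)).continuousOn (fun x hx => ?_)
    (((intervalIntegrable_profile_piece hM hK hn l ha hab hb).const_mul _).const_mul _)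
  rw [profile_upper hM hK hn ⟨ha.trans hx.1.le, hx.2.trans_le hb⟩ l]
  have h1 : HasDerivAt (fun x => lam * (x - M - K)) lam x := by
    simpa using (((hasDerivAt_id x).sub_const M).sub_const K).const_mul lam
  have h := (hasDerivAt_upperProfile (lam * M) n (lam * (x - M - K))).comp x h1
  rw [show lam * (x - M - K) + lam * M = lam * (x - K) by ring] at h
  convert! h using 1
  ring

/-- The balance equation on `[0, M]`. Both integrals are combined over `[0, t]`, where the integrand
is the derivative of `lowerProfile`, which vanishes at the level `0`. -/
lemma integral_profile_lower (hM : 0 < M) (hK : K = (m + 2) * M) {t : ℝ}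
    (ht : t ∈ Icc 0 M) :
    (∫ x in (0 : ℝ)..t, lam * profile lam M K (m + 2) x) +
      ∫ x in M..(t + M), lam * (Real.exp (-(lam * M)) * profile lam M K (m + 2) x) =
      lowerProfile (lam * M) (m + 2) (lam * (t - K)) := by
  have e : K - (m + 1) * M = M := by rw [hK]; ring
  have e' : K - m * M = M + M := by rw [hK]; ring
  have hi : IntervalIntegrable (fun x => lam * (Real.exp (-(lam * M)) * profile lam M K (m + 2) x))
      volume M (t + M) := ((intervalIntegrable_profile_piece hM hK le_rfl _ e.le
        (by linarith [ht.1]) (by linarith [ht.2])).const_mul _).const_mul _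
  have hi' := hi.comp_add_right M
  rw [sub_self, add_sub_cancel_right] at hi'
  have hi0 : IntervalIntegrable (fun x => lam * profile lam M K (m + 2) x) volume 0 t :=
    (intervalIntegrable_profile_lower _ ht.1 ht.2).const_mul _
  have hs := intervalIntegral.integral_comp_add_right (a := 0) (b := t)
    (fun x => lam * (Real.exp (-(lam * M)) * profile lam M K (m + 2) x)) M
  rw [zero_add] at hs
  rw [← hs, ← intervalIntegral.integral_add hi0 hi',
    intervalIntegral.integral_eq_sub_of_hasDerivAt_of_le
    (f := fun x => lowerProfile (lam * M) (m + 2) (lam * (x - K))) ht.1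
    ((continuous_lowerProfile _ _).comp (by fun_prop)).continuousOn (fun x hx => ?_)
    (hi0.add hi')]
  · have : lam * (0 - K) = -(lam * M) * ((m + 2 : ℕ) : ℝ) := by rw [hK]; push_cast; ring
    rw [this, lowerProfile_bottom, sub_zero]
  · rw [profile_lower _ (hx.2.trans_le ht.2), profile_upper hM hK le_rfl
      (by rw [e, e']; constructor <;> linarith [hx.1, hx.2, ht.2])]
    have h1 : HasDerivAt (fun x => lam * (x - K)) lam x := by
      simpa using ((hasDerivAt_id x).sub_const K).const_mul lam
    have h := (hasDerivAt_lowerProfile (lam * M) m (lam * (x - K))).comp x h1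
    rw [show lam * (x - K) + lam * M = lam * (x + M - K) by ring] at h
    convert! h using 1
    ring

/-- The right-hand side of the balance equation at the level `K - (n + 1) M`, without the atom at
`K`. The induction on `k = m - n` adds the intervals from the lowest one upwards. -/
lemma integral_profile_level (hM : 0 < M) (hK : K = (m + 2) * M) :
    ∀ k n : ℕ, n + k = m → IntervalIntegrable (profile lam M K (m + 2)) volume M (K - n * M) ∧
      (∫ x in (0 : ℝ)..M, lam * profile lam M K (m + 2) x) +
        ∫ x in M..(K - n * M), lam * (Real.exp (-(lam * M)) * profile lam M K (m + 2) x) =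
      upperProfile (lam * M) (n + 1) (-(lam * M) * (n + 1)) := by
  intro k
  induction k with
  | zero =>
    rintro n rfl
    have e : K - (n + 1) * M = M := by rw [hK]; push_cast; ring
    have e' : K - n * M = M + M := by rw [hK]; push_cast; ring
    refine ⟨intervalIntegrable_profile_piece hM hK le_rfl _ e.le (by linarith) le_rfl, ?_⟩
    rw [e', add_zero, integral_profile_lower hM hK ⟨hM.le, le_rfl⟩, ← lowerProfile_top, hK]
    congr 1
    push_cast; ring
  | succ k ih =>
    intro n hn
    obtain ⟨h1, h2⟩ := ih (n + 1) (by omega)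
    push_cast at h1 h2
    have hp := intervalIntegrable_profile_piece (lam := lam) (n := n) hM hK (by omega) (m + 2)
      le_rfl (b := K - n * M) (by linarith) le_rfl
    refine ⟨h1.trans hp, ?_⟩
    rw [← intervalIntegral.integral_add_adjacent_intervals ((h1.const_mul _).const_mul _)
      ((hp.const_mul _).const_mul _), ← add_assoc, h2,
      integral_profile_piece hM hK (by omega) _ le_rfl (by linarith) le_rfl]
    rw [show -(lam * M) * ((n : ℝ) + 1 + 1) = -(lam * M) * ((n : ℝ) + 2) by ring,
      upperProfile_match]
    rw [show lam * (K - n * M - M - K) = -(lam * M) * ((n : ℝ) + 1) by ring,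
      show lam * (K - (n + 1) * M - M - K) = -(lam * M) * ((n : ℝ) + 2) by ring]
    ring

lemma intervalIntegrable_profile (hM : 0 < M) (hK : K = (m + 2) * M) :
    IntervalIntegrable (profile lam M K (m + 2)) volume 0 K := by
  have h := (integral_profile_level (lam := lam) hM hK m 0 (by simp)).1
  rw [Nat.cast_zero, zero_mul, sub_zero] at h
  exact (intervalIntegrable_profile_lower _ hM.le le_rfl).trans h

/-- The balance equation in terms of the profile: the integrals collect the levels `x ≤ M` and
`x > M` from which level `t` can be reached, the last term is the atom at `K`. -/
lemma profile_balance (hM : 0 < M) (hK : K = (m + 2) * M) {t : ℝ} (ht : t ∈ Ico 0 K) :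
    profile lam M K (m + 2) t =
      (∫ x in (0 : ℝ)..(min t M), lam * profile lam M K (m + 2) x) +
      (∫ x in M..(min (t + M) K), lam * (Real.exp (-(lam * M)) * profile lam M K (m + 2) x)) +
      if K - M ≤ t then Real.exp (-(lam * M)) else 0 := by
  have hm : (0 : ℝ) ≤ m * M := by positivity
  rcases lt_or_ge t M with htM | htM
  · rw [min_eq_left htM.le, min_eq_left (by rw [hK]; linarith),
      if_neg (by rw [hK]; push Not; linarith), add_zero,
      integral_profile_lower hM hK ⟨ht.1, htM.le⟩, profile_lower _ htM]
  · rw [min_eq_right htM]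
    obtain ⟨n, hn, hx⟩ := exists_mem_piece hM hK ⟨htM, ht.2⟩
    rw [profile_upper hM hK hn hx]
    -- For `n = 0` all levels above `M` contribute, and the atom at `K` fills the jump at `K - M`.
    rcases n with _ | n
    · simp only [Nat.cast_zero, zero_add, one_mul, zero_mul, sub_zero] at hx
      have h := (integral_profile_level (lam := lam) hM hK m 0 (by simp)).2
      simp only [Nat.cast_zero, zero_mul, sub_zero, zero_add, mul_one] at h
      rw [upperProfile_one_neg] at h
      rw [min_eq_right (by linarith [hx.1]), if_pos hx.1, h, upperProfile_zero]
      ring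
    · push_cast at hx
      have hnM : (0 : ℝ) ≤ n * M := by positivity
      obtain ⟨h1, h2⟩ := integral_profile_level (lam := lam) hM hK (m - (n + 1)) (n + 1) (by omega)
      push_cast at h1 h2
      have hp := intervalIntegrable_profile_piece (lam := lam) (n := n) hM hK (by omega) (m + 2)
        (a := K - (n + 1) * M) (b := t + M) le_rfl (by linarith [hx.1]) (by linarith [hx.2])
      rw [min_eq_left (by linarith [hx.2]), if_neg (by linarith [hx.2]), add_zero,
        ← intervalIntegral.integral_add_adjacent_intervals ((h1.const_mul _).const_mul _)
        ((hp.const_mul _).const_mul _), ← add_assoc, h2,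
        integral_profile_piece hM hK (by omega) _ le_rfl (by linarith [hx.1]) (by linarith [hx.2])]
      rw [show -(lam * M) * ((n : ℝ) + 1 + 1) = -(lam * M) * ((n : ℝ) + 2) by ring,
        upperProfile_match,
        show lam * (K - (n + 1) * M - M - K) = -(lam * M) * ((n : ℝ) + 2) by ring,
        add_sub_cancel_right]
      ring

end Profile

/-! ### Balanced densities -/

/-- The level left in the buffer after transmission, before the next harvest. -/
noncomputable def drain (M b : ℝ) : ℝ := b - if M < b then M else 0

/-- The density at `t < K` of the next level, given the present level `b`. -/
noncomputable def stepDensity (lam M b t : ℝ) : ℝ := exponentialPDFReal lam (t - drain M b)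

/-- The stationarity equation on `[0, K)` for a law with density `g` on `[0, K)` and an atom of mass
`p` at `K`. No sign is required of `g`. -/
def IsBalanced (lam M K p : ℝ) (g : ℝ → ℝ) : Prop :=
  ∀ t ∈ Ico 0 K, g t = (∫ b in Ico 0 K, stepDensity lam M b t * g b) + p * stepDensity lam M K t

lemma measurable_drain (M : ℝ) : Measurable (drain M) :=
  measurable_id.sub (Measurable.ite measurableSet_Ioi measurable_const measurable_const)

lemma drain_nonneg {M b : ℝ} (hb : 0 ≤ b) : 0 ≤ drain M b := by
  unfold drain; split_ifs <;> linarith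

lemma bufferStep_eq (M K b x : ℝ) : bufferStep M K b x = min (drain M b + x) K := rfl

lemma measurable_bufferStep (M K : ℝ) :
    Measurable fun p : ℝ × ℝ => bufferStep M K p.1 p.2 :=
  (((measurable_drain M).comp measurable_fst).add measurable_snd).min measurable_const

lemma bufferStep_mem_Icc {M K b x : ℝ} (hK : 0 ≤ K) (hb : 0 ≤ b) (hx : 0 ≤ x) :
    bufferStep M K b x ∈ Icc 0 K :=
  ⟨le_min (add_nonneg (drain_nonneg hb) hx) hK, min_le_right _ _⟩

lemma bufferStep_of_le {M K b x : ℝ} (hb : 0 ≤ b) (hx : K ≤ x) : bufferStep M K b x = K := by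
  rw [bufferStep_eq]
  exact min_eq_right (by linarith [drain_nonneg (M := M) hb])

lemma measurable_stepDensity (lam M : ℝ) :
    Measurable fun p : ℝ × ℝ => stepDensity lam M p.1 p.2 :=
  (measurable_exponentialPDFReal lam).comp
    (measurable_snd.sub ((measurable_drain M).comp measurable_fst))

lemma exponentialPDFReal_eq (lam x : ℝ) :
    exponentialPDFReal lam x = if 0 ≤ x then lam * Real.exp (-(lam * x)) else 0 := by
  simp [exponentialPDFReal, gammaPDFReal]

lemma stepDensity_nonneg {lam : ℝ} (hlam : 0 < lam) (M b t : ℝ) : 0 ≤ stepDensity lam M b t :=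
  exponentialPDFReal_nonneg hlam _

lemma stepDensity_le {lam : ℝ} (hlam : 0 < lam) (M b t : ℝ) : stepDensity lam M b t ≤ lam := by
  rw [stepDensity, exponentialPDFReal_eq]
  split_ifs with h
  · have : Real.exp (-(lam * (t - drain M b))) ≤ 1 :=
      Real.exp_le_one_iff.2 (neg_nonpos.2 (mul_nonneg hlam.le h))
    nlinarith
  · exact hlam.le

/-- Below the capacity `K`, the next level has density `stepDensity lam M b`. -/
lemma expMeasure_bufferStep_mem (lam M : ℝ) {K : ℝ} (b : ℝ) {A : Set ℝ} (hA : MeasurableSet A)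
    (hAK : A ⊆ Iio K) :
    expMeasure lam {x | bufferStep M K b x ∈ A} =
      ∫⁻ t in A, ENNReal.ofReal (stepDensity lam M b t) := by
  have hset : {x | bufferStep M K b x ∈ A} = (fun x => x + drain M b) ⁻¹' A := by
    ext x
    simp only [mem_ofPred_eq, mem_preimage, bufferStep_eq, add_comm x]
    -- Truncation at `K` does not matter, as neither `K` nor anything above it lies in `A`.
    rcases lt_or_ge (drain M b + x) K with h | h
    · rw [min_eq_left h.le]
    · rw [min_eq_right h]
      exact ⟨fun h' => absurd (hAK h') (lt_irrefl K), fun h' => absurd (hAK h') (not_lt.2 h)⟩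
  have hm : MeasurableSet ((fun x => x + drain M b) ⁻¹' A) := (measurable_add_const _) hA
  have h0 : expMeasure lam = volume.withDensity (exponentialPDF lam) := rfl
  rw [hset, h0, withDensity_apply _ hm, ← lintegral_indicator hm, ← lintegral_indicator hA,
    ← lintegral_sub_right_eq_self _ (drain M b)]
  refine lintegral_congr fun t => ?_
  by_cases ht : t ∈ A
  · rw [indicator_of_mem ht, indicator_of_mem (by simpa using ht)]
    rfl
  · rw [indicator_of_notMem ht, indicator_of_notMem (by simpa using ht)]

lemma expMeasure_Iio_lt_one {lam : ℝ} (hlam : 0 < lam) {K : ℝ} (hK : 0 ≤ K) :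
    expMeasure lam (Iio K) < 1 := by
  have := isProbabilityMeasure_expMeasure hlam
  refine (measure_mono Iio_subset_Iic_self).trans_lt ?_
  have h := cdf_expMeasure_eq hlam K
  rw [cdf_eq_real, if_pos hK] at h
  have h1 : (expMeasure lam).real (Iic K) < 1 := by rw [h]; linarith [Real.exp_pos (-(lam * K))]
  rw [← ENNReal.ofReal_toReal (measure_ne_top (expMeasure lam) (Iic K))]
  exact ENNReal.ofReal_lt_one.2 h1

lemma expMeasure_real_Iio_lt_one {lam : ℝ} (hlam : 0 < lam) {K : ℝ} (hK : 0 ≤ K) :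
    (expMeasure lam).real (Iio K) < 1 := by
  have := isProbabilityMeasure_expMeasure hlam
  simpa [measureReal_def] using (ENNReal.toReal_lt_toReal (measure_ne_top _ _)
    ENNReal.one_ne_top).2 (expMeasure_Iio_lt_one hlam hK)

lemma integrable_stepDensity_mul {lam : ℝ} (hlam : 0 < lam) (M t : ℝ) {g : ℝ → ℝ} {S : Set ℝ}
    (hg : IntegrableOn g S) : IntegrableOn (fun b => stepDensity lam M b t * g b) S := by
  refine Integrable.bdd_mul (c := lam) hg
    ((measurable_stepDensity lam M).comp measurable_prodMk_right).aestronglyMeasurable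
    (ae_of_all _ fun b => ?_)
  rw [Real.norm_of_nonneg (stepDensity_nonneg hlam ..)]
  exact stepDensity_le hlam ..

lemma ofReal_integral_le_lintegral {α : Type*} [MeasurableSpace α] {μ : Measure α} {f : α → ℝ}
    (hf : Integrable f μ) : ENNReal.ofReal (∫ a, f a ∂μ) ≤ ∫⁻ a, ENNReal.ofReal (f a) ∂μ := by
  rw [integral_eq_lintegral_pos_part_sub_lintegral_neg_part hf]
  exact (ENNReal.ofReal_le_ofReal (sub_le_self _ ENNReal.toReal_nonneg)).trans
    ENNReal.ofReal_toReal_le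

/-- A balanced density is nonnegative if its atom is: the chain loses a fixed proportion of the mass
of the negative part to `K` in each step, so this negative part vanishes. -/
lemma IsBalanced.nonneg {lam M K p : ℝ} {g : ℝ → ℝ} (hlam : 0 < lam) (hK : 0 ≤ K)
    (hp : 0 ≤ p) (hg : IsBalanced lam M K p g) (hint : IntegrableOn g (Ico 0 K)) :
    ∀ t ∈ Ico 0 K, 0 ≤ g t := by
  set N : ℝ → ENNReal := fun b => ENNReal.ofReal (-g b) with hN
  have hNm : AEMeasurable N (volume.restrict (Ico 0 K)) :=
    hint.aestronglyMeasurable.aemeasurable.neg.ennreal_ofReal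
  have hkm : Measurable fun q : ℝ × ℝ => ENNReal.ofReal (stepDensity lam M q.1 q.2) :=
    (measurable_stepDensity lam M).ennreal_ofReal
  have hle : ∀ t ∈ Ico 0 K,
      N t ≤ ∫⁻ b in Ico 0 K, ENNReal.ofReal (stepDensity lam M b t) * N b := by
    intro t ht
    have h1 : -g t ≤ ∫ b in Ico 0 K, stepDensity lam M b t * -g b := by
      have := mul_nonneg hp (stepDensity_nonneg hlam M K t)
      simp only [mul_neg, integral_neg]
      linarith [hg t ht]
    refine (ENNReal.ofReal_le_ofReal h1).trans
      ((ofReal_integral_le_lintegral (integrable_stepDensity_mul hlam M t hint.neg)).trans ?_)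
    refine lintegral_mono fun b => ?_
    rw [ENNReal.ofReal_mul (stepDensity_nonneg hlam ..)]
    rfl
  set c := expMeasure lam (Iio K) with hc
  have hmass : ∀ b ∈ Ico 0 K, ∫⁻ t in Ico 0 K, ENNReal.ofReal (stepDensity lam M b t) ≤ c := by
    intro b hb
    rw [← expMeasure_bufferStep_mem lam M b measurableSet_Ico Ico_subset_Iio_self]
    refine measure_mono fun x hx => ?_
    -- A harvest of at least `K` leads to the level `K`, outside `[0, K)`.
    by_contra hxK
    rw [mem_ofPred_eq, bufferStep_of_le hb.1 (not_lt.1 hxK)] at hx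
    exact lt_irrefl _ hx.2
  have hS : ∫⁻ t in Ico 0 K, N t ≤ c * ∫⁻ t in Ico 0 K, N t := by
    calc ∫⁻ t in Ico 0 K, N t
        ≤ ∫⁻ t in Ico 0 K, ∫⁻ b in Ico 0 K, ENNReal.ofReal (stepDensity lam M b t) * N b :=
          setLIntegral_mono' measurableSet_Ico hle
      _ = ∫⁻ b in Ico 0 K, ∫⁻ t in Ico 0 K, ENNReal.ofReal (stepDensity lam M b t) * N b :=
          lintegral_lintegral_swap
            ((hkm.comp measurable_swap).aemeasurable.mul hNm.comp_snd)
      _ ≤ ∫⁻ b in Ico 0 K, c * N b := by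
          refine setLIntegral_mono' measurableSet_Ico fun b hb => ?_
          rw [lintegral_mul_const (N b) (f := fun t => ENNReal.ofReal (stepDensity lam M b t))
            (hkm.comp measurable_prodMk_left)]
          gcongr
          exact hmass b hb
      _ = c * ∫⁻ t in Ico 0 K, N t := lintegral_const_mul'' _ hNm
  have hfin : ∫⁻ t in Ico 0 K, N t ≠ ⊤ :=
    (hint.neg.lintegral_lt_top).ne
  have hzero : ∫⁻ t in Ico 0 K, N t = 0 := by
    by_contra hne
    have := ENNReal.mul_lt_mul_left hne hfin (expMeasure_Iio_lt_one hlam hK)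
    rw [one_mul] at this
    exact absurd hS (not_le.2 (by simpa [mul_comm] using this))
  rw [lintegral_eq_zero_iff' hNm] at hzero
  intro t ht
  rw [hg t ht]
  refine add_nonneg (integral_nonneg_of_ae ?_) (mul_nonneg hp (stepDensity_nonneg hlam ..))
  filter_upwards [hzero] with b hb
  have : -g b ≤ 0 := ENNReal.ofReal_eq_zero.1 hb
  exact mul_nonneg (stepDensity_nonneg hlam ..) (by linarith)

/-! ### The explicit balanced density -/

/-- The stationary density, normalized so that the atom at `K` has mass `1`. -/
noncomputable def rawDensity (lam M K : ℝ) (l : ℕ) (x : ℝ) : ℝ :=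
  lam * Real.exp (-(lam * (x - K))) * profile lam M K l x

section RawDensity

variable {lam M K : ℝ} {m : ℕ}

lemma integrableOn_rawDensity (hM : 0 < M) (hK : K = (m + 2) * M) :
    IntegrableOn (rawDensity lam M K (m + 2)) (Ico 0 K) := by
  have h0 : 0 ≤ K := by rw [hK]; positivity
  rw [integrableOn_Ico_iff_integrableOn_Ioo, ← integrableOn_Ioc_iff_integrableOn_Ioo,
    ← intervalIntegrable_iff_integrableOn_Ioc_of_le h0]
  exact (intervalIntegrable_profile hM hK).continuousOn_mul
    (Continuous.continuousOn (by fun_prop))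

/-- Of the levels `b ≤ M` those up to `t` contribute at `t`, of the levels `b > M` those up to
`t + M`; after factoring out `lam * e^(-lam (t - K))` this is `profile_balance`. -/
lemma isBalanced_rawDensity (hM : 0 < M) (hK : K = (m + 2) * M) :
    IsBalanced lam M K 1 (rawDensity lam M K (m + 2)) := by
  intro t ht
  have hm : (0 : ℝ) ≤ m * M := by positivity
  have hMK : M ≤ K := by rw [hK]; linarith
  have hMK' : M < K := by rw [hK]; linarith
  set φ := profile lam M K (m + 2) with hφ
  set F : ℝ → ℝ := fun b =>
    if drain M b ≤ t then lam * (Real.exp (-(lam * (b - drain M b))) * φ b) else 0 with hF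
  have hφi := intervalIntegrable_profile (lam := lam) hM hK
  -- `F` is the integrand of the balance equation without the factor depending on `t`.
  have hkF : ∀ b, stepDensity lam M b t * rawDensity lam M K (m + 2) b =
      lam * Real.exp (-(lam * (t - K))) * F b := by
    intro b
    simp only [stepDensity, exponentialPDFReal_eq, sub_nonneg, hF, rawDensity]
    split_ifs with h
    · have : Real.exp (-(lam * (t - drain M b))) * Real.exp (-(lam * (b - K))) =
          Real.exp (-(lam * (t - K))) * Real.exp (-(lam * (b - drain M b))) := by
        rw [← Real.exp_add, ← Real.exp_add]; ring_nf
      linear_combination lam * lam * φ b * this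
    · simp
  have hkK : stepDensity lam M K t = lam * Real.exp (-(lam * (t - K))) *
      if K - M ≤ t then Real.exp (-(lam * M)) else 0 := by
    simp only [stepDensity, exponentialPDFReal_eq, sub_nonneg, drain, if_pos hMK']
    split_ifs with h
    · rw [mul_assoc, ← Real.exp_add]; ring_nf
    · simp
  have hd1 : ∀ b < M, drain M b = b := fun b hb => by simp [drain, hb.le]
  have hd2 : ∀ b > M, drain M b = b - M := fun b hb => by simp [drain, hb]
  have ha0 : 0 ≤ min t M := le_min ht.1 hM.le
  have haM : min t M ≤ M := min_le_right _ _
  have hbM : M ≤ min (t + M) K := le_min (by linarith [ht.1]) hMK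
  have hbK : min (t + M) K ≤ K := min_le_right _ _
  -- On the four intervals cut out by `min t M`, `M` and `min (t + M) K`, the indicator is constant.
  have e1 : EqOn (fun b => lam * φ b) F (Ioo 0 (min t M)) := fun b hb => by
    obtain ⟨h1, h2⟩ := lt_min_iff.1 hb.2
    simp [hF, hd1 b h2, h1.le]
  have e2 : EqOn (fun _ => (0 : ℝ)) F (Ioo (min t M) M) := fun b hb => by
    have h1 : t < b := (min_lt_iff.1 hb.1).resolve_right (not_lt.2 hb.2.le)
    simp [hF, hd1 b hb.2, h1]
  have e3 : EqOn (fun b => lam * (Real.exp (-(lam * M)) * φ b)) F (Ioo M (min (t + M) K)) :=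
    fun b hb => by
    obtain ⟨h1, h2⟩ := lt_min_iff.1 hb.2
    simp [hF, hd2 b hb.1, h1.le]
  have e4 : EqOn (fun _ => (0 : ℝ)) F (Ioo (min (t + M) K) K) := fun b hb => by
    have h1 : t + M < b := (min_lt_iff.1 hb.1).resolve_right (not_lt.2 hb.2.le)
    simp [hF, hd2 b (by linarith [ht.1]), h1]
  have hsub : ∀ a b : ℝ, 0 ≤ a → a ≤ b → b ≤ K → IntervalIntegrable φ volume a b :=
    fun a b h1 h2 h3 => hφi.mono_set (by
      rw [uIcc_of_le h2, uIcc_of_le (hM.le.trans hMK)]; exact Icc_subset_Icc h1 h3)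
  have i1 : IntervalIntegrable F volume 0 (min t M) :=
    ((hsub _ _ le_rfl ha0 (haM.trans hMK)).const_mul lam).congr_uIoo (by rwa [uIoo_of_le ha0])
  have i2 : IntervalIntegrable F volume (min t M) M :=
    intervalIntegrable_const.congr_uIoo (by rwa [uIoo_of_le haM])
  have i3 : IntervalIntegrable F volume M (min (t + M) K) :=
    (((hsub _ _ hM.le hbM hbK).const_mul _).const_mul lam).congr_uIoo (by rwa [uIoo_of_le hbM])
  have i4 : IntervalIntegrable F volume (min (t + M) K) K :=
    intervalIntegrable_const.congr_uIoo (by rwa [uIoo_of_le hbK])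
  have hFint : ∫ b in Ico 0 K, F b = (∫ x in (0 : ℝ)..(min t M), lam * φ x) +
      ∫ x in M..(min (t + M) K), lam * (Real.exp (-(lam * M)) * φ x) := by
    rw [integral_Ico_eq_integral_Ioc, ← intervalIntegral.integral_of_le (hM.le.trans hMK),
      ← intervalIntegral.integral_add_adjacent_intervals (i1.trans i2) (i3.trans i4),
      ← intervalIntegral.integral_add_adjacent_intervals i1 i2,
      ← intervalIntegral.integral_add_adjacent_intervals i3 i4,
      ← intervalIntegral.integral_congr_Ioo_of_le ha0 e1,
      ← intervalIntegral.integral_congr_Ioo_of_le haM e2,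
      ← intervalIntegral.integral_congr_Ioo_of_le hbM e3,
      ← intervalIntegral.integral_congr_Ioo_of_le hbK e4]
    simp
  simp only [hkF]
  rw [integral_const_mul, hFint, hkK, one_mul, ← mul_add, ← profile_balance hM hK ht]
  rfl

lemma rawDensity_nonneg (hlam : 0 < lam) (hM : 0 < M) (hK : K = (m + 2) * M) :
    ∀ t ∈ Ico 0 K, 0 ≤ rawDensity lam M K (m + 2) t :=
  (isBalanced_rawDensity hM hK).nonneg hlam (by rw [hK]; positivity) zero_le_one
    (integrableOn_rawDensity hM hK)

end RawDensity

/-! ### Evolution of laws and stationarity -/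

/-- The law of the next level if the present level has law `ν`. -/
noncomputable def stepLaw (M K : ℝ) (ρ ν : Measure ℝ) : Measure ℝ :=
  (ν.prod ρ).map fun p : ℝ × ℝ => bufferStep M K p.1 p.2

instance (M K : ℝ) (ρ ν : Measure ℝ) [IsProbabilityMeasure ρ] [IsProbabilityMeasure ν] :
    IsProbabilityMeasure (stepLaw M K ρ ν) :=
  Measure.isProbabilityMeasure_map (measurable_bufferStep M K).aemeasurable

lemma stepLaw_apply (M K : ℝ) (ρ ν : Measure ℝ) [SFinite ρ] {A : Set ℝ} (hA : MeasurableSet A) :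
    stepLaw M K ρ ν A = ∫⁻ b, ρ {x | bufferStep M K b x ∈ A} ∂ν := by
  rw [stepLaw, Measure.map_apply (measurable_bufferStep M K) hA,
    Measure.prod_apply (measurable_bufferStep M K hA)]
  rfl

lemma expMeasure_Ici_zero {lam : ℝ} (hlam : 0 < lam) : expMeasure lam (Ici 0) = 1 := by
  have := isProbabilityMeasure_expMeasure hlam
  have h : expMeasure lam (Iio 0) = 0 := by
    rw [show expMeasure lam = volume.withDensity (exponentialPDF lam) from rfl,
      withDensity_apply _ measurableSet_Iio]
    exact lintegral_exponentialPDF_of_nonpos le_rfl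
  rw [← compl_Iio]
  exact (prob_compl_eq_one_iff measurableSet_Iio).2 h

lemma stepLaw_Icc {lam : ℝ} (hlam : 0 < lam) (M : ℝ) {K : ℝ} (hK : 0 ≤ K) (ν : Measure ℝ)
    [IsProbabilityMeasure ν] (hν : ν (Icc 0 K) = 1) :
    stepLaw M K (expMeasure lam) ν (Icc 0 K) = 1 := by
  have := isProbabilityMeasure_expMeasure hlam
  rw [stepLaw_apply _ _ _ _ measurableSet_Icc]
  have h : ∀ᵐ b ∂ν, expMeasure lam {x | bufferStep M K b x ∈ Icc 0 K} = 1 := by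
    filter_upwards [(mem_ae_iff_prob_eq_one measurableSet_Icc).2 hν] with b hb
    refine le_antisymm prob_le_one ?_
    rw [← expMeasure_Ici_zero hlam]
    exact measure_mono fun x hx => bufferStep_mem_Icc hK hb.1 hx
  rw [lintegral_congr_ae h]
  simp

/-- Probability measures on `[0, K]` are determined by their restriction to `[0, K)`. -/
lemma ext_of_subset_Ico {K : ℝ} {μ ν : Measure ℝ} [IsProbabilityMeasure μ]
    [IsProbabilityMeasure ν] (hμ : μ (Icc 0 K) = 1) (hν : ν (Icc 0 K) = 1)
    (h : ∀ A, MeasurableSet A → A ⊆ Ico 0 K → μ A = ν A) : μ = ν := by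
  -- For sets containing `K`, pass to the complement.
  have key : ∀ A, MeasurableSet A → K ∉ A → μ A = ν A := by
    intro A hA hKA
    have haux : ∀ τ : Measure ℝ, IsProbabilityMeasure τ → τ (Icc 0 K) = 1 →
        τ A = τ (A ∩ Ico 0 K) := by
      intro τ _ hτ
      refine measure_congr ?_
      filter_upwards [(mem_ae_iff_prob_eq_one measurableSet_Icc).2 hτ] with x hx
      refine propext ⟨fun hxA => ⟨hxA, hx.1, hx.2.lt_of_ne ?_⟩, fun hxA => hxA.1⟩
      rintro rfl
      exact hKA hxA
    rw [haux μ inferInstance hμ, haux ν inferInstance hν]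
    exact h _ (hA.inter measurableSet_Ico) inter_subset_right
  ext A hA
  by_cases hKA : K ∈ A
  · rw [← compl_compl A, prob_compl_eq_one_sub hA.compl, prob_compl_eq_one_sub hA.compl,
      key _ hA.compl (by simpa using hKA)]
  · exact key A hA hKA

/-- The measure with density `g` on `[0, K)` and an atom of mass `p` at `K`. -/
noncomputable def mixedLaw (K p : ℝ) (g : ℝ → ℝ) : Measure ℝ :=
  (volume.restrict (Ico 0 K)).withDensity (fun x => ENNReal.ofReal (g x)) +
    ENNReal.ofReal p • Measure.dirac K

section MixedLaw

variable {K p : ℝ} {g : ℝ → ℝ}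

lemma mixedLaw_apply {A : Set ℝ} (hA : MeasurableSet A) (hAK : A ⊆ Ico 0 K) :
    mixedLaw K p g A = ∫⁻ x in A, ENNReal.ofReal (g x) := by
  have : K ∉ A := fun h => lt_irrefl _ (hAK h).2
  rw [mixedLaw, Measure.add_apply, withDensity_apply _ hA, Measure.restrict_restrict hA,
    inter_eq_self_of_subset_left hAK]
  simp [this]

lemma mixedLaw_singleton : mixedLaw K p g {K} = ENNReal.ofReal p := by
  rw [mixedLaw, Measure.add_apply, withDensity_apply _ (measurableSet_singleton K),
    Measure.restrict_restrict (measurableSet_singleton K)]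
  simp

lemma mixedLaw_Icc (hg : IntegrableOn g (Ico 0 K)) (h0 : ∀ x ∈ Ico 0 K, 0 ≤ g x)
    (hK : 0 ≤ K) (hp : 0 ≤ p) (h1 : (∫ x in Ico 0 K, g x) + p = 1) :
    mixedLaw K p g (Icc 0 K) = 1 := by
  have h0' : 0 ≤ᵐ[volume.restrict (Ico 0 K)] g :=
    (ae_restrict_iff' measurableSet_Ico).2 (ae_of_all _ h0)
  rw [← Ico_union_right hK, measure_union (by simp) (measurableSet_singleton K),
    mixedLaw_singleton, mixedLaw_apply measurableSet_Ico subset_rfl,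
    ← ofReal_integral_eq_lintegral_ofReal hg h0', ← ENNReal.ofReal_add
      (integral_nonneg_of_ae h0') hp, h1, ENNReal.ofReal_one]

lemma isProbabilityMeasure_mixedLaw (hg : IntegrableOn g (Ico 0 K))
    (h0 : ∀ x ∈ Ico 0 K, 0 ≤ g x)
    (hK : 0 ≤ K) (hp : 0 ≤ p) (h1 : (∫ x in Ico 0 K, g x) + p = 1) :
    IsProbabilityMeasure (mixedLaw K p g) := by
  constructor
  have hz : mixedLaw K p g (Icc 0 K)ᶜ = 0 := by
    rw [mixedLaw, Measure.add_apply, withDensity_apply _ measurableSet_Icc.compl,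
      Measure.restrict_restrict measurableSet_Icc.compl,
      ((disjoint_compl_left (a := Icc 0 K)).mono_right Ico_subset_Icc_self).inter_eq]
    simp [hK]
  rw [← measure_add_measure_compl (measurableSet_Icc (a := (0 : ℝ)) (b := K)), hz,
    mixedLaw_Icc hg h0 hK hp h1, add_zero]

lemma isStationaryDistribution_mixedLaw {lam M : ℝ} (hlam : 0 < lam)
    (hb : IsBalanced lam M K p g) (hg : IntegrableOn g (Ico 0 K)) (h0 : ∀ x ∈ Ico 0 K, 0 ≤ g x)
    (hK : 0 ≤ K) (hp : 0 ≤ p) (h1 : (∫ x in Ico 0 K, g x) + p = 1) :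
    IsStationaryDistribution M K (expMeasure lam) (mixedLaw K p g) := by
  have hpr := isProbabilityMeasure_mixedLaw hg h0 hK hp h1
  have hI := mixedLaw_Icc hg h0 hK hp h1
  have hρ := isProbabilityMeasure_expMeasure hlam
  refine ⟨hpr, hI, ?_⟩
  refine ext_of_subset_Ico (μ := stepLaw M K (expMeasure lam) (mixedLaw K p g))
    (stepLaw_Icc hlam M hK _ hI) hI fun A hA hAK => ?_
  have hkm : Measurable fun q : ℝ × ℝ => ENNReal.ofReal (stepDensity lam M q.1 q.2) :=
    (measurable_stepDensity lam M).ennreal_ofReal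
  rw [stepLaw_apply _ _ _ _ hA, mixedLaw_apply hA hAK]
  calc ∫⁻ b, expMeasure lam {x | bufferStep M K b x ∈ A} ∂(mixedLaw K p g)
      = ∫⁻ b, (∫⁻ t in A, ENNReal.ofReal (stepDensity lam M b t)) ∂(mixedLaw K p g) :=
        lintegral_congr fun b =>
          expMeasure_bufferStep_mem lam M b hA (hAK.trans Ico_subset_Iio_self)
    _ = ∫⁻ t in A, ∫⁻ b, ENNReal.ofReal (stepDensity lam M b t) ∂(mixedLaw K p g) :=
        lintegral_lintegral_swap hkm.aemeasurable
    _ = ∫⁻ t in A, ENNReal.ofReal (g t) := by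
        refine setLIntegral_congr_fun hA fun t ht => ?_
        have hkt : Measurable fun b => ENNReal.ofReal (stepDensity lam M b t) :=
          hkm.comp measurable_prodMk_right
        rw [mixedLaw, lintegral_add_measure, lintegral_smul_measure, lintegral_dirac' _ hkt,
          lintegral_withDensity_eq_lintegral_mul₀ hg.aestronglyMeasurable.aemeasurable.ennreal_ofReal
            hkt.aemeasurable, hb t (hAK ht)]
        have hnn : 0 ≤ᵐ[volume.restrict (Ico 0 K)] fun b => stepDensity lam M b t * g b :=
          (ae_restrict_iff' measurableSet_Ico).2
            (ae_of_all _ fun b hb => mul_nonneg (stepDensity_nonneg hlam ..) (h0 b hb))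
        rw [ENNReal.ofReal_add (integral_nonneg_of_ae hnn)
          (mul_nonneg hp (stepDensity_nonneg hlam ..)), ENNReal.ofReal_mul hp,
          ofReal_integral_eq_lintegral_ofReal (integrable_stepDensity_mul hlam M t hg) hnn,
          smul_eq_mul]
        congr 1
        refine lintegral_congr fun b => ?_
        rw [ENNReal.ofReal_mul (stepDensity_nonneg hlam ..), mul_comm]
        rfl

end MixedLaw

/-! ### Geometric contraction -/

section Contraction

variable {M K : ℝ} {ρ : Measure ℝ} [IsProbabilityMeasure ρ]

/-- The part of the transition operator, applied to `f`, that comes from harvests below `K`. From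
levels `b ≥ 0`, the other harvests lead to `K`. -/
noncomputable def residual (M K : ℝ) (ρ : Measure ℝ) (f : ℝ → ℝ) (b : ℝ) : ℝ :=
  ∫ x in Iio K, f (bufferStep M K b x) ∂ρ

lemma measurable_residual {f : ℝ → ℝ} (hf : Measurable f) : Measurable (residual M K ρ f) :=
  (StronglyMeasurable.integral_prod_right (ν := ρ.restrict (Iio K))
    (f := fun b x => f (bufferStep M K b x))
    (hf.comp (measurable_bufferStep M K)).stronglyMeasurable).measurable

lemma integrable_of_bounds {α : Type*} [MeasurableSpace α] {ν : Measure α} [IsFiniteMeasure ν]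
    {f : α → ℝ} {C : ℝ} (hf : Measurable f) (h : ∀ x, f x ∈ Icc 0 C) : Integrable f ν :=
  Integrable.of_bound hf.aestronglyMeasurable C
    (ae_of_all _ fun x => by rw [Real.norm_of_nonneg (h x).1]; exact (h x).2)

lemma residual_mem_Icc {f : ℝ → ℝ} {C : ℝ} (hf : Measurable f) (h : ∀ x, f x ∈ Icc 0 C) (b : ℝ) :
    residual M K ρ f b ∈ Icc 0 (C * ρ.real (Iio K)) := by
  refine ⟨integral_nonneg fun x => (h _).1, ?_⟩
  have hm : Measurable fun x => f (bufferStep M K b x) :=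
    hf.comp ((measurable_bufferStep M K).comp measurable_prodMk_left)
  calc residual M K ρ f b ≤ ∫ _ in Iio K, C ∂ρ :=
        integral_mono (integrable_of_bounds hm fun x => h _) (integrable_const _) fun x => (h _).2
    _ = C * ρ.real (Iio K) := by simp [mul_comm]

/-- The Doeblin decomposition: the second term does not depend on the law `ν`. -/
lemma integral_stepLaw {f : ℝ → ℝ} {C : ℝ} (hf : Measurable f) (h : ∀ x, f x ∈ Icc 0 C)
    {ν : Measure ℝ} [IsProbabilityMeasure ν] (hν : ν (Icc 0 K) = 1) :
    ∫ x, f x ∂(stepLaw M K ρ ν) = (∫ b, residual M K ρ f b ∂ν) + f K * ρ.real (Ici K) := by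
  have hm : Measurable fun q : ℝ × ℝ => f (bufferStep M K q.1 q.2) :=
    hf.comp (measurable_bufferStep M K)
  rw [stepLaw, integral_map (measurable_bufferStep M K).aemeasurable hf.aestronglyMeasurable,
    integral_prod _ (integrable_of_bounds hm fun x => h _)]
  have hae : ∀ᵐ b ∂ν, ∫ x, f (bufferStep M K b x) ∂ρ =
      residual M K ρ f b + f K * ρ.real (Ici K) := by
    filter_upwards [(mem_ae_iff_prob_eq_one measurableSet_Icc).2 hν] with b hb
    have hi : Integrable (fun x => f (bufferStep M K b x)) ρ :=
      integrable_of_bounds (hm.comp measurable_prodMk_left) fun x => h _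
    rw [← integral_add_compl (measurableSet_Iio (a := K)) hi, residual, compl_Iio,
      setIntegral_congr_fun measurableSet_Ici (g := fun _ => f K)
        fun x hx => by simp only [bufferStep_of_le hb.1 hx]]
    simp [mul_comm]
  rw [integral_congr_ae hae, integral_add (integrable_of_bounds (measurable_residual hf)
    (residual_mem_Icc hf h)) (integrable_const _)]
  simp

/-- Two evolutions of the chain approach each other at the geometric rate `P(X < K)`. The bound is
uniform in `f`, which lets the induction replace `f` by its residual. -/
lemma abs_integral_sub_le {ν μ : ℕ → Measure ℝ} [∀ n, IsProbabilityMeasure (ν n)]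
    [∀ n, IsProbabilityMeasure (μ n)] (hν : ∀ n, ν n (Icc 0 K) = 1) (hμ : ∀ n, μ n (Icc 0 K) = 1)
    (hνs : ∀ n, ν (n + 1) = stepLaw M K ρ (ν n)) (hμs : ∀ n, μ (n + 1) = stepLaw M K ρ (μ n))
    (n : ℕ) : ∀ (f : ℝ → ℝ) (C : ℝ), Measurable f → (∀ x, f x ∈ Icc 0 C) →
      |∫ x, f x ∂(ν n) - ∫ x, f x ∂(μ n)| ≤ C * ρ.real (Iio K) ^ n := by
  induction n with
  | zero =>
    intro f C hf h
    have haux : ∀ τ : Measure ℝ, IsProbabilityMeasure τ → ∫ x, f x ∂τ ∈ Icc 0 C := by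
      intro τ _
      refine ⟨integral_nonneg fun x => (h x).1, ?_⟩
      calc ∫ x, f x ∂τ ≤ ∫ _, C ∂τ :=
            integral_mono (integrable_of_bounds hf h) (integrable_const _) fun x => (h x).2
        _ = C := by simp
    have h1 := haux (ν 0) inferInstance
    have h2 := haux (μ 0) inferInstance
    rw [pow_zero, mul_one, abs_le]
    constructor <;> linarith [h1.1, h1.2, h2.1, h2.2]
  | succ n ih =>
    intro f C hf h
    rw [hνs, hμs, integral_stepLaw hf h (hν n), integral_stepLaw hf h (hμ n),
      add_sub_add_right_eq_sub]
    refine (ih _ _ (measurable_residual hf) (residual_mem_Icc hf h)).trans_eq ?_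
    rw [pow_succ]; ring

lemma abs_measureReal_sub_le {ν μ : ℕ → Measure ℝ} [∀ n, IsProbabilityMeasure (ν n)]
    [∀ n, IsProbabilityMeasure (μ n)] (hν : ∀ n, ν n (Icc 0 K) = 1) (hμ : ∀ n, μ n (Icc 0 K) = 1)
    (hνs : ∀ n, ν (n + 1) = stepLaw M K ρ (ν n)) (hμs : ∀ n, μ (n + 1) = stepLaw M K ρ (μ n))
    (n : ℕ) {A : Set ℝ} (hA : MeasurableSet A) :
    |(ν n).real A - (μ n).real A| ≤ ρ.real (Iio K) ^ n := by
  have h := abs_integral_sub_le hν hμ hνs hμs n (A.indicator 1) 1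
    (measurable_one.indicator hA) fun x => by
      by_cases hx : x ∈ A <;> simp [hx]
  simpa [integral_indicator_one hA] using h

lemma _root_.IsStationaryDistribution.unique (hK : ρ.real (Iio K) < 1) {μ ν : Measure ℝ}
    (hμ : IsStationaryDistribution M K ρ μ) (hν : IsStationaryDistribution M K ρ ν) : ν = μ := by
  have := hμ.isProbabilityMeasure
  have := hν.isProbabilityMeasure
  ext A hA
  have hb : ∀ n, |ν.real A - μ.real A| ≤ ρ.real (Iio K) ^ n := fun n =>
    abs_measureReal_sub_le (M := M) (ν := fun _ => ν) (μ := fun _ => μ)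
      (fun _ => hν.mem_space) (fun _ => hμ.mem_space)
      (fun _ => hν.invariant.symm) (fun _ => hμ.invariant.symm) n hA
  have h0 : |ν.real A - μ.real A| ≤ 0 :=
    ge_of_tendsto' (tendsto_pow_atTop_nhds_zero_of_lt_one measureReal_nonneg hK) hb
  have h1 : ν.real A = μ.real A := sub_eq_zero.1 (abs_nonpos_iff.1 h0)
  exact (measureReal_eq_measureReal_iff).1 h1

end Contraction

/-! ### The laws of the storage process -/

section Laws

variable {Ω : Type*} [MeasurableSpace Ω] {P : Measure Ω}
  {M K : ℝ} {ρ : Measure ℝ} {X B : ℕ → Ω → ℝ}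

/-- The level at time `n` is a function of the initial level and the first `n` harvests. -/
lemma exists_factorization (hB : IsStorageProcess P M K ρ X B) (n : ℕ) :
    ∃ F : ℝ × (Finset.range n → ℝ) → ℝ, Measurable F ∧
      ∀ ω, B n ω = F (B 0 ω, fun i => X i ω) := by
  induction n with
  | zero => exact ⟨Prod.fst, measurable_fst, fun _ => rfl⟩
  | succ n ih =>
    obtain ⟨F, hF, h⟩ := ih
    refine ⟨fun q => bufferStep M K
      (F (q.1, fun i => q.2 ⟨i, Finset.mem_range.2 ((Finset.mem_range.1 i.2).trans n.lt_succ_self)⟩))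
      (q.2 ⟨n, Finset.self_mem_range_succ n⟩), ?_, fun ω => ?_⟩
    · refine (measurable_bufferStep M K).comp (Measurable.prodMk (hF.comp ?_) (by fun_prop))
      fun_prop
    · rw [hB.step, h]

lemma _root_.IsStorageProcess.measurable (hB : IsStorageProcess P M K ρ X B) (n : ℕ) :
    Measurable (B n) := by
  obtain ⟨F, hF, h⟩ := exists_factorization hB n
  have hX := hB.measurable_energy
  have h0 := hB.measurable_init
  rw [show B n = fun ω => F (B 0 ω, fun i : Finset.range n => X i ω) from funext h]
  exact hF.comp (by fun_prop)

variable [IsProbabilityMeasure P]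

lemma indepFun_prodMk_of_indepFun {α β γ : Type*} [MeasurableSpace α] [MeasurableSpace β]
    [MeasurableSpace γ] {U : Ω → α} {V : Ω → β} {W : Ω → γ} (hU : Measurable U)
    (hV : Measurable V) (hW : Measurable W) (h : IndepFun U (fun ω => (V ω, W ω)) P)
    (hVW : IndepFun V W P) : IndepFun (fun ω => (U ω, V ω)) W P := by
  have := Measure.isProbabilityMeasure_map (μ := P) hU.aemeasurable
  have := Measure.isProbabilityMeasure_map (μ := P) hV.aemeasurable
  have := Measure.isProbabilityMeasure_map (μ := P) hW.aemeasurable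
  have hUV : IndepFun U V P := h.comp measurable_id measurable_fst
  rw [indepFun_iff_map_prod_eq_prod_map_map (by fun_prop) (by fun_prop)] at *
  rw [hVW] at h
  rw [hUV]
  -- The joint law of `(U, (V, W))` is a triple product; reassociate it.
  have e := (measurePreserving_prodAssoc (P.map U) (P.map V) (P.map W)).symm.map_eq
  rw [← e, ← h, Measure.map_map (MeasurableEquiv.measurable _) (by fun_prop)]
  rfl

lemma _root_.IsStorageProcess.indepFun (hB : IsStorageProcess P M K ρ X B) (n : ℕ) :
    IndepFun (B n) (X n) P := by
  obtain ⟨F, hF, h⟩ := exists_factorization hB n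
  have hX := hB.measurable_energy
  have hVW : IndepFun (fun ω (i : Finset.range n) => X i ω) (X n) P :=
    (hB.indep_energy.indepFun_finset (Finset.range n) {n} (by simp) hX).comp measurable_id
      (measurable_pi_apply (⟨n, Finset.mem_singleton_self n⟩ : ({n} : Finset ℕ)))
  have hU : IndepFun (B 0) (fun ω => ((fun i : Finset.range n => X i ω), X n ω)) P :=
    hB.indep_init.comp (φ := id)
      (ψ := fun x : ℕ → ℝ => ((fun i : Finset.range n => x i), x n)) measurable_id (by fun_prop)
  have hind := indepFun_prodMk_of_indepFun hB.measurable_init (by fun_prop) (hX n) hU hVW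
  rw [show B n = F ∘ fun ω => (B 0 ω, fun i : Finset.range n => X i ω) from funext h]
  exact hind.comp hF measurable_id

lemma _root_.IsStorageProcess.map_succ (hB : IsStorageProcess P M K ρ X B) (n : ℕ) :
    P.map (B (n + 1)) = stepLaw M K ρ (P.map (B n)) := by
  have hm : Measurable fun ω => (B n ω, X n ω) :=
    (hB.measurable n).prodMk (hB.measurable_energy n)
  rw [stepLaw, ← hB.law_energy n, ← (hB.indepFun n).map_prod_eq_prod_map_map
    (hB.measurable n).aemeasurable (hB.measurable_energy n).aemeasurable,
    Measure.map_map (measurable_bufferStep M K) hm]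
  exact congrArg (fun Y => P.map Y) (funext fun ω => hB.step n ω)

lemma _root_.IsStorageProcess.isLimitingDistribution {lam : ℝ} (hlam : 0 < lam) (hK : 0 ≤ K)
    (hB : IsStorageProcess P M K (expMeasure lam) X B) {μ : Measure ℝ}
    (hμ : IsStationaryDistribution M K (expMeasure lam) μ) :
    IsLimitingDistribution P M K (expMeasure lam) B μ := by
  refine ⟨hμ, ?_⟩
  have := isProbabilityMeasure_expMeasure hlam
  have := hμ.isProbabilityMeasure
  have hpr : ∀ n, IsProbabilityMeasure (P.map (B n)) := fun n =>
    Measure.isProbabilityMeasure_map (hB.measurable n).aemeasurable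
  have hI : ∀ n, P.map (B n) (Icc 0 K) = 1 := by
    intro n
    induction n with
    | zero =>
      rw [Measure.map_apply hB.measurable_init measurableSet_Icc,
        show B 0 ⁻¹' Icc 0 K = univ from eq_univ_of_forall hB.init_mem, measure_univ]
    | succ n ih => rw [hB.map_succ]; exact stepLaw_Icc hlam M hK _ ih
  have hc := expMeasure_real_Iio_lt_one hlam hK
  intro ε hε
  filter_upwards [(tendsto_pow_atTop_nhds_zero_of_lt_one measureReal_nonneg hc).eventually_le_const
    hε] with n hn A hA
  exact (abs_measureReal_sub_le (μ := fun _ => μ) hI (fun _ => hμ.mem_space) hB.map_succ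
    (fun _ => hμ.invariant.symm) n hA).trans hn

end Laws

/-! ### Closed formulas and total mass -/

/-- The zeroth term of `abelSum` is `1`, and its term of index `q` combines with the term of index
`q - 1` of `abelSumDeriv`. -/
lemma upperProfile_eq (δ : ℝ) (n : ℕ) (y : ℝ) :
    upperProfile δ n y = 1 + ∑ q ∈ Finset.Icc 1 n, Real.exp (-δ * q) / ((q - 1).factorial : ℝ) *
      (δ * q + y) ^ (q - 1) * (y / q + δ - 1) := by
  have h : Finset.Icc 1 n = Finset.Ico 1 (n + 1) := rfl
  rw [h, Finset.sum_Ico_eq_sum_range, upperProfile, abelSum, abelSumDeriv, Finset.sum_range_succ']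
  simp only [Nat.cast_zero, mul_zero, Real.exp_zero, Nat.factorial_zero, Nat.cast_one, div_one,
    pow_zero, mul_one, Nat.add_sub_cancel]
  rw [add_sub_right_comm, ← Finset.sum_sub_distrib, add_comm]
  congr 1
  refine Finset.sum_congr rfl fun q _ => ?_
  rw [add_comm 1 q, Nat.add_sub_cancel, Nat.factorial_succ]
  have := Nat.factorial_ne_zero q
  push_cast
  field_simp
  ring

lemma integrableOn_pow_mul_exp_neg (q : ℕ) (z : ℝ) :
    IntegrableOn (fun t : ℝ => t ^ q * Real.exp (-t)) (Ioi z) := by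
  refine integrable_of_isBigO_exp_neg (b := 1 / 2) (by norm_num)
    (Continuous.continuousOn (by fun_prop)) ?_
  have h := (isLittleO_pow_exp_pos_mul_atTop (k := q) (b := 1 / 2) (by norm_num)).isBigO.mul
    (Asymptotics.isBigO_refl (fun t : ℝ => Real.exp (-t)) atTop)
  refine h.trans_eventuallyEq (Eventually.of_forall fun t => ?_)
  simp only [← Real.exp_add]
  ring_nf

lemma upperGamma_sub_upperGamma (q : ℕ) (a b : ℝ) :
    upperGamma (q + 1) b - upperGamma (q + 1) a = -∫ t in a..b, t ^ q * Real.exp (-t) := by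
  have h := intervalIntegral.integral_interval_add_Ioi (integrableOn_pow_mul_exp_neg q a)
    (integrableOn_pow_mul_exp_neg q b)
  simp only [upperGamma, Nat.add_sub_cancel]
  linarith

section RawDensity

variable {lam M K : ℝ} {l : ℕ}

/-- The stationary density on `[0, M)` in closed form. -/
lemma rawDensity_lower (hK : K = l * M) {x : ℝ} (hx : x < M) :
    rawDensity lam M K l x = lam * Real.exp (-(lam * M) * (1 - l)) *
      ∑ q ∈ Finset.range (l - 1), Real.exp (-(lam * M) * q) / (q.factorial : ℝ) *
        ((lam * M * (q + 1) - lam * K) ^ q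
          - Real.exp (-lam * x) * (lam * M * (q + 1) + lam * (x - K)) ^ q) := by
  rw [rawDensity, profile_lower l hx, lowerProfile, abelSumDeriv, abelSumDeriv, Finset.mul_sum,
    ← Finset.sum_sub_distrib, Finset.mul_sum, Finset.mul_sum]
  refine Finset.sum_congr rfl fun q _ => ?_
  have e1 : Real.exp (-(lam * M) * (q + 1)) =
      Real.exp (-(lam * M) * q) * Real.exp (-(lam * M)) := by
    rw [← Real.exp_add]; ring_nf
  have e2 : Real.exp (-(lam * (x - K))) * Real.exp (lam * (x - K) + lam * M * l) *
      Real.exp (-(lam * M)) = Real.exp (-(lam * M) * (1 - l)) := by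
    rw [← Real.exp_add, ← Real.exp_add]; ring_nf
  have e3 : Real.exp (-(lam * (x - K))) * Real.exp (-(lam * M)) =
      Real.exp (-(lam * M) * (1 - l)) * Real.exp (-lam * x) := by
    rw [← Real.exp_add, ← Real.exp_add, hK]; ring_nf
  have e4 : lam * M * ((q : ℝ) + 1) + -(lam * M) * l = lam * M * (q + 1) - lam * K := by
    rw [hK]; ring
  rw [e1, e4]
  linear_combination lam * Real.exp (-(lam * M) * q) / (q.factorial : ℝ) *
    ((lam * M * (q + 1) - lam * K) ^ q * e2 - (lam * M * (q + 1) + lam * (x - K)) ^ q * e3)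

/-- The mass of `[0, M)`. The substitution `t = lam * (M * (q + 1 - l) + x)` turns the terms into
incomplete gamma integrals. -/
lemma integral_rawDensity_lower (hM : 0 < M) (hK : K = l * M) :
    ∫ x in (0 : ℝ)..M, rawDensity lam M K l x = Real.exp (-(lam * M) * (1 - l)) *
      ∑ q ∈ Finset.range (l - 1), Real.exp (-(lam * M) * q) / (q.factorial : ℝ) *
        (Real.exp (lam * M * (q + 1 - l)) *
          (upperGamma (q + 1) (lam * M * (q + 2 - l)) - upperGamma (q + 1) (lam * M * (q + 1 - l)))
          + lam * M * (lam * M * (q + 1 - l)) ^ q) := by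
  rw [intervalIntegral.integral_congr_Ioo_of_le hM.le fun x hx => rawDensity_lower hK hx.2,
    intervalIntegral.integral_const_mul, intervalIntegral.integral_finsetSum
    fun q _ => Continuous.intervalIntegrable (by fun_prop) _ _, mul_comm lam, mul_assoc,
    Finset.mul_sum]
  congr 1
  refine Finset.sum_congr rfl fun q _ => ?_
  have e4 : lam * M * ((q : ℝ) + 1) - lam * K = lam * M * (q + 1 - l) := by rw [hK]; ring
  rw [intervalIntegral.integral_const_mul, intervalIntegral.integral_sub
    intervalIntegrable_const (Continuous.intervalIntegrable (by fun_prop) _ _),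
    intervalIntegral.integral_const, e4]
  have h := intervalIntegral.smul_integral_comp_add_mul (a := 0) (b := M)
    (fun t : ℝ => t ^ q * Real.exp (-t)) lam (lam * M * (q + 1 - l))
  have hx : ∀ x : ℝ, Real.exp (-lam * x) * (lam * M * (q + 1) + lam * (x - K)) ^ q =
      Real.exp (lam * M * (q + 1 - l)) * ((lam * M * (q + 1 - l) + lam * x) ^ q *
        Real.exp (-(lam * M * (q + 1 - l) + lam * x))) := by
    intro x
    rw [show lam * M * ((q : ℝ) + 1) + lam * (x - K) = lam * M * (q + 1 - l) + lam * x by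
      rw [hK]; ring, neg_add, Real.exp_add, Real.exp_neg (lam * M * (q + 1 - l)), neg_mul]
    field_simp
  simp only [hx]
  rw [intervalIntegral.integral_const_mul, upperGamma_sub_upperGamma,
    show lam * M * ((q : ℝ) + 2 - l) = lam * M * (q + 1 - l) + lam * M by ring]
  rw [mul_zero, add_zero, smul_eq_mul] at h
  rw [← h, sub_zero, smul_eq_mul]
  ring

/-- The mass of `[K - (n + 1) M, K - n M)`: there the density is the derivative of
`-e^(-y) * abelSum (lam * M) n y` with respect to `x`, where `y = lam * (x - K)`. -/
lemma integral_rawDensity_piece {m : ℕ} (hM : 0 < M) (hK : K = (m + 2) * M) {n : ℕ}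
    (hn : n ≤ m) (l : ℕ) :
    ∫ x in (K - (n + 1) * M)..(K - n * M), rawDensity lam M K l x =
      Real.exp (n * (lam * M)) *
        ∑ q ∈ Finset.range (n + 1), (lam * M * Real.exp (-(lam * M))) ^ q / (q.factorial : ℝ) *
          (Real.exp (lam * M) * ((q : ℝ) - (n + 1)) ^ q - ((q : ℝ) - n) ^ q) := by
  have hle : K - (n + 1) * M ≤ K - n * M := by linarith
  have hi : IntervalIntegrable (rawDensity lam M K l) volume (K - (n + 1) * M) (K - n * M) :=
    (intervalIntegrable_profile_piece hM hK hn l le_rfl hle le_rfl).continuousOn_mul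
      (Continuous.continuousOn (by fun_prop))
  have hA := continuous_abelSum (lam * M) n
  rw [intervalIntegral.integral_eq_sub_of_hasDerivAt_of_le
    (f := fun x => -(Real.exp (-(lam * (x - K))) * abelSum (lam * M) n (lam * (x - K)))) hle
    (Continuous.continuousOn (by fun_prop)) (fun x hx => ?_) hi]
  · rw [show lam * (K - n * M - K) = -(lam * M * n) by ring,
      show lam * (K - (n + 1) * M - K) = -(lam * M * (n + 1)) by ring, neg_neg, neg_neg,
      neg_sub_neg, abelSum, abelSum, Finset.mul_sum, Finset.mul_sum, ← Finset.sum_sub_distrib,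
      Finset.mul_sum]
    refine Finset.sum_congr rfl fun q _ => ?_
    rw [show lam * M * (q : ℝ) + -(lam * M * (n + 1)) = lam * M * (q - (n + 1)) by ring,
      show lam * M * (q : ℝ) + -(lam * M * n) = lam * M * (q - n) by ring,
      mul_pow (lam * M), mul_pow (lam * M), mul_pow (lam * M), mul_add, mul_one, Real.exp_add,
      ← Real.exp_nat_mul, mul_comm (n : ℝ), mul_comm (q : ℝ) (-(lam * M))]
    ring
  · rw [rawDensity, profile_upper hM hK hn ⟨hx.1.le, hx.2⟩, upperProfile]
    have h1 : HasDerivAt (fun x => lam * (x - K)) lam x := by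
      simpa using ((hasDerivAt_id x).sub_const K).const_mul lam
    have h := (h1.neg.exp.mul ((hasDerivAt_abelSum (lam * M) n (lam * (x - K))).comp x h1)).neg
    convert! h using 1
    simp only [Function.comp, Pi.neg_apply]
    ring

lemma integral_rawDensity {m : ℕ} (hM : 0 < M) (hK : K = (m + 2) * M) :
    ∫ x in Ico 0 K, rawDensity lam M K (m + 2) x =
      (∑ n ∈ Finset.range (m + 1), ∫ x in (K - (n + 1) * M)..(K - n * M),
        rawDensity lam M K (m + 2) x) + ∫ x in (0 : ℝ)..M, rawDensity lam M K (m + 2) x := by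
  have hK0 : 0 ≤ K := by rw [hK]; positivity
  have hm : (0 : ℝ) ≤ m * M := by positivity
  have hMK : M ≤ K := by rw [hK]; linarith
  have hi : IntervalIntegrable (rawDensity lam M K (m + 2)) volume 0 K :=
    (intervalIntegrable_profile hM hK).continuousOn_mul (Continuous.continuousOn (by fun_prop))
  have hs := intervalIntegral.sum_integral_adjacent_intervals
    (f := rawDensity lam M K (m + 2)) (μ := volume) (a := fun n : ℕ => K - n * M) (n := m + 1)
    fun n hn => by
      push_cast
      exact (((intervalIntegrable_profile_piece hM hK (Nat.lt_succ_iff.1 hn) (m + 2) le_rfl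
        (by linarith) le_rfl).continuousOn_mul (Continuous.continuousOn (by fun_prop))).symm)
  simp only [Nat.cast_zero, zero_mul, sub_zero] at hs
  push_cast at hs
  rw [show K - ((m : ℝ) + 1) * M = M by rw [hK]; ring] at hs
  have h0M : IntervalIntegrable (rawDensity lam M K (m + 2)) volume 0 M := hi.mono_set (by
    rw [uIcc_of_le hM.le, uIcc_of_le hK0]; exact Icc_subset_Icc le_rfl hMK)
  have hMKi : IntervalIntegrable (rawDensity lam M K (m + 2)) volume M K := hi.mono_set (by
    rw [uIcc_of_le hMK, uIcc_of_le hK0]; exact Icc_subset_Icc hM.le le_rfl)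
  rw [integral_Ico_eq_integral_Ioc, ← intervalIntegral.integral_of_le hK0,
    ← intervalIntegral.integral_add_adjacent_intervals h0M hMKi, add_comm]
  congr 1
  rw [intervalIntegral.integral_symm, ← hs, ← Finset.sum_neg_distrib]
  exact Finset.sum_congr rfl fun n _ => by rw [← intervalIntegral.integral_symm]

end RawDensity

end StorageProcess

open StorageProcess in
theorem corollary2 {Ω : Type*} [MeasurableSpace Ω] (P : Measure Ω) [IsProbabilityMeasure P]
    (lam M K δ : ℝ) (l : ℕ) (hlam : 0 < lam) (hM : 0 < M) (hl : 2 ≤ l)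
    (hK : K = l * M) (hδ : δ = lam * M) (X B : ℕ → Ω → ℝ)
    (hB : IsStorageProcess P M K (expMeasure lam) X B) :
    ∃ (μ : Measure ℝ) (g : ℝ → ℝ) (piK : ℝ),
      IsLimitingDistribution P M K (expMeasure lam) B μ ∧
      (∀ ν : Measure ℝ, IsStationaryDistribution M K (expMeasure lam) ν → ν = μ) ∧
      IsDensityOn μ (Ico 0 K) g ∧
      μ.real {K} = piK ∧ 0 < piK ∧
      (∀ x ∈ Ico 0 M,
        g x = piK * lam * Real.exp (-δ * (1 - l)) *
          ∑ q ∈ Finset.range (l - 1), Real.exp (-δ * q) / (q.factorial : ℝ) *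
            ((δ * (q + 1) - lam * K) ^ q
              - Real.exp (-lam * x) * (δ * (q + 1) + lam * (x - K)) ^ q)) ∧
      (∀ n : ℕ, n ≤ l - 2 → ∀ x ∈ Ico (K - (n + 1) * M) (K - n * M),
        g x = piK * lam * Real.exp (-lam * (x - K)) *
          (1 + ∑ q ∈ Finset.Icc 1 n, Real.exp (-δ * q) / ((q - 1).factorial : ℝ) *
            (δ * q + lam * (x - K)) ^ (q - 1) * (lam * (x - K) / q + δ - 1))) ∧
      piK =
        (1 + ∑ n ∈ Finset.range (l - 1), Real.exp (n * δ) *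
            ∑ q ∈ Finset.range (n + 1), (δ * Real.exp (-δ)) ^ q / (q.factorial : ℝ) *
              (Real.exp δ * ((q : ℝ) - (n + 1)) ^ q - ((q : ℝ) - n) ^ q)
          + Real.exp (-δ * (1 - l)) *
            ∑ q ∈ Finset.range (l - 1), Real.exp (-δ * q) / (q.factorial : ℝ) *
              (Real.exp (δ * (q + 1 - l)) *
                  (upperGamma (q + 1) (δ * (q + 2 - l)) - upperGamma (q + 1) (δ * (q + 1 - l)))
                + δ * (δ * (q + 1 - l)) ^ q))⁻¹ := by
  subst hδ
  obtain ⟨m, rfl⟩ : ∃ m, l = m + 2 := ⟨l - 2, by omega⟩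
  have hK' : K = (m + 2) * M := by rw [hK]; push_cast; ring
  have hK0 : 0 ≤ K := by rw [hK']; positivity
  set w := rawDensity lam M K (m + 2) with hw
  have hwi : IntegrableOn w (Ico 0 K) := integrableOn_rawDensity hM hK'
  have hw0 : ∀ x ∈ Ico 0 K, 0 ≤ w x := rawDensity_nonneg hlam hM hK'
  have hwI : 0 ≤ ∫ x in Ico 0 K, w x := setIntegral_nonneg measurableSet_Ico hw0
  have hden := integral_rawDensity (lam := lam) hM hK'
  rw [Finset.sum_congr rfl fun n hn => integral_rawDensity_piece (lam := lam) hM hK'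
    (Nat.lt_succ_iff.1 (Finset.mem_range.1 hn)) (m + 2), integral_rawDensity_lower hM hK,
    ← hw] at hden
  set p : ℝ := (1 + ∫ x in Ico 0 K, w x)⁻¹ with hp
  have hp0 : 0 < p := by positivity
  set g : ℝ → ℝ := fun x => p * w x with hg
  have hgi : IntegrableOn g (Ico 0 K) := hwi.const_mul p
  have hg0 : ∀ x ∈ Ico 0 K, 0 ≤ g x := fun x hx => mul_nonneg hp0.le (hw0 x hx)
  have hg1 : (∫ x in Ico 0 K, g x) + p = 1 := by
    rw [hg, integral_const_mul, hp]; field_simp; ring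
  have hgb : IsBalanced lam M K p g := by
    intro t ht
    have h := isBalanced_rawDensity (lam := lam) hM hK' t ht
    have hc : ∀ b, stepDensity lam M b t * g b = p * (stepDensity lam M b t * w b) :=
      fun b => by simp only [hg]; ring
    simp only [hc]
    rw [integral_const_mul]
    simp only [hg]
    rw [hw, h]; ring
  have hμ := isStationaryDistribution_mixedLaw hlam hgb hgi hg0 hK0 hp0.le hg1
  have := isProbabilityMeasure_expMeasure hlam
  refine ⟨mixedLaw K p g, g, p, hB.isLimitingDistribution hlam hK0 hμ,
    fun ν hν => hμ.unique (expMeasure_real_Iio_lt_one hlam hK0) hν,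
    ⟨hg0, hgi, fun A hA hAK => ?_⟩, ?_, hp0, fun x hx => ?_,
    fun n hn x hx => ?_, ?_⟩
  · rw [measureReal_def, mixedLaw_apply hA hAK, integral_eq_lintegral_of_nonneg_ae
      ((ae_restrict_iff' hA).2 (ae_of_all _ fun x hx => hg0 x (hAK hx)))
      (hgi.mono_set hAK).aestronglyMeasurable]
  · rw [measureReal_def, mixedLaw_singleton, ENNReal.toReal_ofReal hp0.le]
  · simp only [hg, hw]
    rw [rawDensity_lower hK hx.2]
    ring
  · simp only [hg, hw]
    rw [rawDensity, profile_upper hM hK' hn hx, upperProfile_eq]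
    rw [neg_mul lam]
    ring
  · rw [hp, hden, ← add_assoc]
    rfl
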